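/- Let $\xi(s)=\pi^{-s/2}\,\Gamma(s/2)\,\zeta(s)$ be the completed Riemann zeta function (continued meromorphically to $\mathbb C$, with simple poles at $s=0$ and $s=1$). For a real number $T\ge 1$ consider the function $$\xi^T_{\mathbb Q,2}(s)=\frac{\xi(2s)}{s-1}\,T^{s-1}-\frac{\xi(2s-1)}{s}\,T^{-s}.$$ For every real $T\ge 1$, $\xi^T_{\mathbb Q,2}$ is a meromorphic function on $\mathbb C$, and all of its zeros (the points where it has positive order) lie on the critical line $\operatorname{Re}(s)=\tfrac12$. -/

import Mathlib

/-- The function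
`ξ^T_{ℚ,2}(s) = ξ(2s) T^(s-1) / (s-1) - ξ(2s-1) T^(-s) / s`,
where `ξ(s) = π^(-s/2) Γ(s/2) ζ(s)` is the completed Riemann zeta function. At the points
`s = 0, 1/2, 1`, where the formula is undefined, Lean assigns it arbitrary values; it is to be
read as a meromorphic function on `ℂ`. -/
noncomputable def rankTwoXi (T : ℝ) (s : ℂ) : ℂ :=
  completedRiemannZeta (2 * s) / (s - 1) * (T : ℂ) ^ (s - 1)
    - completedRiemannZeta (2 * s - 1) / s * (T : ℂ) ^ (-s)

/-!
Let `X(s) = s (s - 1) ξ(s)`, an entire function with `X(1 - s) = X(s)` (`entireXi`). Clearing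
denominators,

  `2 s (s - 1) (2 s - 1) ξ^T_{ℚ,2}(s) = X(2s) T^(s-1) - X(2s-1) T^(-s)`,

an entire function that is odd under `s ↦ 1 - s`. So it suffices that it has no zero with
`Re s > 1/2`. There `T^(-Re s) ≤ T^(Re s - 1)` because `T ≥ 1`, and everything reduces to the
inequality `|X(z)| < |X(z + 1)|` for `Re z > 0` (`norm_entireXi_lt_norm_entireXi_add_one`).

The inequality is usually read off the Hadamard product of `X`. Here it is obtained from the
Phragmén–Lindelöf principle, applied to `f(z) = X(z) / X(z + 1)` on `Re z ≥ 0`. This function is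
holomorphic there because `ζ` has no zeros on `Re s ≥ 1`, and on the imaginary axis the functional
equation and conjugation symmetry give `|f| = 1`. Three elementary bounds yield
`|f(z)| ≤ 2 (1 + 2|z|) (1 + 2 Re z) / (Re z)^2` (`norm_xiQuotient_le`): the quotient of Gamma factors
is a Beta integral; `(s - 1) ζ(s) = s - s (s - 1) ∫_1^∞ {t} t^(-s-1) dt` for `Re s > 0`; and
`|1 / ζ(s)| ≤ ζ(Re s)` for `Re s > 1`. The maximum principle on rectangles removes the factor
`(Re z)^(-2)` near the imaginary axis (`norm_xiQuotient_le_of_re_le_one`), so `f` has polynomial growth and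
Phragmén–Lindelöf gives `|f| ≤ 1`. Equality at an interior point would force `|f| = 1` throughout,
contradicting `f(1) = 3 / π`.
-/

open scoped ComplexConjugate LSeries.notation
open Complex MeasureTheory Set Filter Topology Asymptotics ArithmeticFunction

/-! ### Archimedean factors -/

/-- On `Re u ≥ 1` the integrand of `B(u, 1/2)` is dominated by `(1 - t) ^ (-1/2)`. -/
lemma norm_betaIntegral_one_half_le {u : ℂ} (hu : 1 ≤ u.re) :
    ‖betaIntegral u (1 / 2)‖ ≤ 2 := by
  have hint : ∫ t in (0 : ℝ)..1, (1 - t) ^ (-(1 / 2) : ℝ) = 2 := by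
    rw [intervalIntegral.integral_comp_sub_left (fun t : ℝ ↦ t ^ (-(1 / 2) : ℝ)),
      integral_rpow (by norm_num)]
    norm_num
  have hi : IntervalIntegrable (fun t : ℝ ↦ (1 - t) ^ (-(1 / 2) : ℝ)) volume 0 1 := by
    have := (intervalIntegral.intervalIntegrable_rpow' (a := 0) (b := 1)
      (r := -(1 / 2)) (by norm_num)).comp_sub_left 1
    simpa using this.symm
  rw [betaIntegral, ← hint]
  refine intervalIntegral.norm_integral_le_of_norm_le zero_le_one ?_ hi
  have hne : ∀ᵐ t : ℝ, t ≠ 1 := by simp [ae_iff, measure_singleton]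
  filter_upwards [hne] with t ht1 ht
  have h1 : 0 < 1 - t := sub_pos.2 (lt_of_le_of_ne ht.2 ht1)
  have h2 : ‖(t : ℂ) ^ (u - 1)‖ ≤ 1 := by
    rw [norm_cpow_eq_rpow_re_of_pos ht.1]
    exact Real.rpow_le_one ht.1.le ht.2 (by simpa using hu)
  have h3 : ‖(1 - (t : ℂ)) ^ ((1 / 2 : ℂ) - 1)‖ = (1 - t) ^ (-(1 / 2) : ℝ) := by
    rw [← ofReal_one, ← ofReal_sub, norm_cpow_eq_rpow_re_of_pos h1]
    norm_num
  rw [norm_mul, h3]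
  exact mul_le_of_le_one_left (by positivity) h2

/-- The quotient `Γ_ℝ(z) / Γ_ℝ(z + 1)` equals `B(z/2, 1/2)`. Only `Re z > 0` is available, so the
Beta integral is bounded at `(z + 2) / 2` instead, where the argument has real part at least `1`, and
the recurrence of `Γ_ℝ` brings the bound back to `z`. -/
lemma norm_Gammaℝ_div_Gammaℝ_add_one_le {z : ℂ} (hz : 0 < z.re) :
    ‖Gammaℝ z / Gammaℝ (z + 1)‖ ≤ 2 * (‖z + 1‖ / ‖z‖) := by
  have hz0 : z ≠ 0 := by rintro rfl; simp at hz
  have hz1 : z + 1 ≠ 0 := by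
    intro h; have := congrArg re h; simp at this; linarith
  have h2 : 0 < (z + 2).re := by simp; linarith
  have h3 : 0 < (z + 1).re := by simp; linarith
  have key : Gammaℝ (z + 2) / Gammaℝ (z + 1 + 2) = betaIntegral ((z + 2) / 2) (1 / 2) := by
    rw [betaIntegral_eq_Gamma_mul_div _ _ (by simpa using h2) (by norm_num), Gamma_one_half_eq,
      Gammaℝ_def, Gammaℝ_def,
      show (z + 2) / 2 + 1 / 2 = (z + 1 + 2) / 2 by ring,
      show -(z + 2) / 2 = -(z + 1 + 2) / 2 + 1 / 2 by ring,
      cpow_add _ _ (by exact_mod_cast Real.pi_ne_zero)]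
    have : (Real.pi : ℂ) ^ (-(z + 1 + 2) / 2) ≠ 0 := by
      rw [Ne, cpow_eq_zero_iff]; simp [Real.pi_ne_zero]
    field_simp
  rw [Gammaℝ_add_two hz0, Gammaℝ_add_two hz1] at key
  have hG := Gammaℝ_ne_zero_of_re_pos h3
  have hpi : (Real.pi : ℂ) ≠ 0 := by exact_mod_cast Real.pi_ne_zero
  have : Gammaℝ z / Gammaℝ (z + 1) = betaIntegral ((z + 2) / 2) (1 / 2) * ((z + 1) / z) := by
    rw [← key]; field_simp
  rw [this, norm_mul, norm_div]
  gcongr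
  refine norm_betaIntegral_one_half_le ?_
  simp; linarith

lemma Gammaℝ_conj (s : ℂ) : Gammaℝ (conj s) = conj (Gammaℝ s) := by
  rw [Gammaℝ_def, Gammaℝ_def, map_mul, ← Gamma_conj,
    show -conj s / 2 = conj (-s / 2) by simp [map_ofNat], cpow_conj]
  · simp [map_ofNat]
  · rw [arg_ofReal_of_nonneg Real.pi_pos.le]
    exact Real.pi_pos.ne

/-! ### Bounds for the zeta function -/

/-- The fractional part of `t` for `t > 1`, and `0` for `t ≤ 1`. Its Mellin transform at `-s` is
`∫_1^∞ {t} t^(-s-1) dt`. -/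
noncomputable def fractTail (t : ℝ) : ℂ :=
  (Ioi (1 : ℝ)).indicator (fun t ↦ ((Int.fract t : ℝ) : ℂ)) t

lemma norm_fractTail_le (t : ℝ) : ‖fractTail t‖ ≤ (Ioi (1 : ℝ)).indicator 1 t := by
  unfold fractTail
  by_cases h : t ∈ Ioi (1 : ℝ)
  · simp only [h, indicator_of_mem, norm_real, Pi.one_apply]
    rw [Real.norm_of_nonneg (Int.fract_nonneg t)]
    exact (Int.fract_lt_one t).le
  · simp [h]

lemma measurable_fractTail : Measurable fractTail :=
  (measurable_ofReal.comp measurable_fract).indicator measurableSet_Ioi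

lemma mellin_differentiableAt_fractTail {s : ℂ} (hs : s.re < 0) :
    DifferentiableAt ℂ (mellin fractTail) s := by
  have hb (t : ℝ) : ‖fractTail t‖ ≤ 1 := by
    refine (norm_fractTail_le t).trans ?_
    exact indicator_le_self' (by simp) t
  refine mellin_differentiableAt_of_isBigO_rpow (a := 0) (b := s.re - 1) ?_ ?_ hs ?_ (by linarith)
  · refine LocallyIntegrable.locallyIntegrableOn ?_ _
    refine (locallyIntegrable_const (1 : ℝ)).mono measurable_fractTail.aestronglyMeasurable ?_
    exact Eventually.of_forall fun t ↦ by simpa using hb t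
  · exact IsBigO.of_bound 1 (Eventually.of_forall fun t ↦ by simpa using hb t)
  · refine IsBigO.congr' (f₁ := fun _ ↦ (0 : ℂ)) (isBigO_zero _ _) ?_ EventuallyEq.rfl
    filter_upwards [mem_nhdsWithin_of_mem_nhds (Iio_mem_nhds one_pos)] with t ht
    simp [fractTail, le_of_lt (show t < 1 from ht)]

lemma mellin_fractTail (s : ℂ) :
    mellin fractTail s = ∫ t in Ioi (1 : ℝ), (t : ℂ) ^ (s - 1) • fractTail t := by
  rw [mellin]
  refine setIntegral_eq_of_subset_of_forall_sdiff_eq_zero measurableSet_Ioi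
    (Ioi_subset_Ioi zero_le_one) fun t ht ↦ ?_
  simp [fractTail, ht.2]

lemma norm_mellin_fractTail_le {s : ℂ} (hs : 0 < s.re) :
    ‖mellin fractTail (-s)‖ ≤ 1 / s.re := by
  have hint : ∫ t in Ioi (1 : ℝ), t ^ (-s.re - 1) = 1 / s.re := by
    rw [integral_Ioi_rpow_of_lt (by linarith) one_pos]
    simp
  have hi := integrableOn_Ioi_rpow_of_lt (a := -s.re - 1) (by linarith) one_pos
  rw [mellin_fractTail, ← hint]
  refine norm_integral_le_of_norm_le hi ?_
  filter_upwards [ae_restrict_mem measurableSet_Ioi] with t ht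
  have ht0 : (0 : ℝ) < t := one_pos.trans ht
  rw [norm_smul, norm_cpow_eq_rpow_re_of_pos ht0]
  have := norm_fractTail_le t
  rw [indicator_of_mem ht] at this
  simpa using mul_le_of_le_one_right (by positivity) this

/-- Partial summation, with `⌊t⌋` written as `t - {t}`. -/
lemma riemannZeta_eq_sub_mellin_of_one_lt_re {s : ℂ} (hs : 1 < s.re) :
    riemannZeta s = s / (s - 1) - s * mellin fractTail (-s) := by
  have hs1 : s - 1 ≠ 0 := by
    intro h; have := congrArg re h; simp at this; linarith
  have hL := LSeries_eq_mul_integral_of_nonneg (fun _ ↦ 1) zero_le_one hs ?_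
    fun _ ↦ zero_le_one
  swap
  · simpa using (isBigO_refl (fun n : ℕ ↦ (n : ℝ)) atTop)
  have hz : riemannZeta s = LSeries (fun n ↦ ((1 : ℝ) : ℂ)) s := by
    rw [← LSeries_one_eq_riemannZeta hs]; simp; rfl
  have hi1 : IntegrableOn (fun t : ℝ ↦ (t : ℂ) ^ (-s)) (Ioi 1) :=
    integrableOn_Ioi_cpow_of_lt (by simpa using hs) one_pos
  have hi2 : IntegrableOn (fun t : ℝ ↦ (t : ℂ) ^ (-s - 1) • fractTail t) (Ioi 1) := by
    refine (integrableOn_Ioi_rpow_of_lt (a := -s.re - 1) (by linarith) one_pos).mono' ?_ ?_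
    · have h := (integrableOn_Ioi_cpow_of_lt (a := -s - 1) (c := 1) (by simp; linarith) one_pos).1
      exact h.smul measurable_fractTail.aestronglyMeasurable
    · filter_upwards [ae_restrict_mem measurableSet_Ioi] with t ht
      rw [norm_smul, norm_cpow_eq_rpow_re_of_pos (one_pos.trans ht)]
      have := norm_fractTail_le t
      rw [indicator_of_mem ht] at this
      simpa using mul_le_of_le_one_right
        (Real.rpow_nonneg (one_pos.trans ht).le (-s.re - 1)) this
  have h1 : ∫ t in Ioi (1 : ℝ), (t : ℂ) ^ (-s) = 1 / (s - 1) := by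
    rw [integral_Ioi_cpow_of_lt (by simpa using hs) one_pos, ofReal_one, one_cpow,
      show -s + 1 = -(s - 1) by ring, neg_div_neg_eq]
  rw [hz, hL, mellin_fractTail, div_eq_mul_one_div, ← mul_sub, ← h1, ← integral_sub hi1 hi2]
  congr 1
  refine setIntegral_congr_fun measurableSet_Ioi fun t ht ↦ ?_
  have ht0 : (t : ℂ) ≠ 0 := by exact_mod_cast (one_pos.trans ht).ne'
  have hf : (⌊t⌋₊ : ℂ) = t - ((Int.fract t : ℝ) : ℂ) := by
    rw [← Int.self_sub_floor, ← natCast_floor_eq_intCast_floor (one_pos.trans ht).le]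
    simp
  have ht' : t ∈ Ioi (1 : ℝ) := ht
  have hp : (t : ℂ) ^ (-s) = t * (t : ℂ) ^ (-s - 1) := by
    rw [cpow_sub _ _ ht0, cpow_one]; field_simp
  simp only [fractTail, indicator_of_mem ht', ofReal_one, Finset.sum_const, Nat.card_Icc,
    add_tsub_cancel_right, nsmul_eq_mul, mul_one, smul_eq_mul, hf, hp, neg_add']
  ring

/-- Analytic continuation of `riemannZeta_eq_sub_mellin_of_one_lt_re` to the half-plane `Re s > 0`,
for `riemannZeta₁ s = (s - 1) ζ(s)`, which has no pole. -/
lemma riemannZeta₁_eq {s : ℂ} (hs : 0 < s.re) :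
    riemannZeta₁ s = s - s * (s - 1) * mellin fractTail (-s) := by
  have hU : IsOpen {z : ℂ | 0 < z.re} := isOpen_lt continuous_const continuous_re
  have hV : IsOpen {z : ℂ | 1 < z.re} := isOpen_lt continuous_const continuous_re
  have hd : DifferentiableOn ℂ (fun s ↦ s - s * (s - 1) * mellin fractTail (-s))
      {z : ℂ | 0 < z.re} := by
    intro z hz
    have : DifferentiableAt ℂ (fun s ↦ mellin fractTail (-s)) z :=
      DifferentiableAt.comp (f := fun s : ℂ ↦ -s) z
        (mellin_differentiableAt_fractTail (by simpa using hz)) (by fun_prop)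
    exact DifferentiableAt.differentiableWithinAt (by fun_prop)
  have hζ := differentiable_riemannZeta₁.differentiableOn.analyticOnNhd hU
  refine hζ.eqOn_of_preconnected_of_eventuallyEq (hd.analyticOnNhd hU)
    (convex_halfSpace_re_gt 0).isPreconnected (z₀ := 2) (by simp) ?_ hs
  filter_upwards [hV.mem_nhds (show (2 : ℂ) ∈ {z : ℂ | 1 < z.re} by simp)] with z hz
  have hz1 : z - 1 ≠ 0 := by
    intro h; have := congrArg re h; simp at this; linarith [show 1 < z.re from hz]
  have := riemannZeta_eq_sub_mellin_of_one_lt_re hz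
  rw [riemannZeta_eq_inv_sub_mul (sub_ne_zero.1 hz1), inv_mul_eq_iff_eq_mul₀ hz1] at this
  rw [this]
  field_simp

lemma norm_riemannZeta₁_le {s : ℂ} (hs : 0 < s.re) :
    ‖riemannZeta₁ s‖ ≤ ‖s‖ * (1 + ‖s - 1‖ / s.re) := by
  rw [riemannZeta₁_eq hs, show s - s * (s - 1) * mellin fractTail (-s)
    = s * (1 - (s - 1) * mellin fractTail (-s)) by ring, norm_mul]
  gcongr
  refine (norm_sub_le _ _).trans ?_
  rw [norm_one, norm_mul, div_eq_mul_one_div]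
  gcongr
  exact norm_mellin_fractTail_le hs

/-- The Dirichlet coefficients `μ(n)` of `1 / ζ` are bounded by those of `ζ`. -/
lemma norm_inv_riemannZeta_le_norm_riemannZeta_re {s : ℂ} (hs : 1 < s.re) :
    ‖(riemannZeta s)⁻¹‖ ≤ ‖riemannZeta s.re‖ := by
  have h1 : (riemannZeta s)⁻¹ = LSeries ↗ArithmeticFunction.moebius s := by
    have := LSeries_one_mul_Lseries_moebius hs
    rw [LSeries_one_eq_riemannZeta hs] at this
    exact inv_eq_of_mul_eq_one_right this
  have hs' : 1 < (s.re : ℂ).re := by simpa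
  have h2 : riemannZeta s.re = ∑' n : ℕ, ((‖LSeries.term 1 s n‖ : ℝ) : ℂ) := by
    rw [← LSeries_one_eq_riemannZeta hs', LSeries]
    refine tsum_congr fun n ↦ ?_
    rw [LSeries.norm_term_eq, LSeries.term_def]
    split_ifs
    · simp
    · simp [ofReal_cpow (Nat.cast_nonneg n)]
  have hsum : Summable fun n ↦ ‖LSeries.term 1 s n‖ :=
    ((LSeriesSummable_one_iff).2 hs).norm
  rw [h1, h2, ← ofReal_tsum, norm_real, Real.norm_of_nonneg (tsum_nonneg fun _ ↦ norm_nonneg _),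
    LSeries]
  refine tsum_of_norm_bounded hsum.hasSum fun n ↦ ?_
  refine LSeries.norm_term_le s ?_
  simp only [Pi.one_apply, norm_one, norm_intCast]
  exact_mod_cast abs_moebius_le_one

lemma norm_inv_riemannZeta_le {z : ℂ} (hz : 0 < z.re) :
    ‖(riemannZeta (z + 1))⁻¹‖ ≤ (1 + 2 * z.re) / z.re := by
  have h := norm_inv_riemannZeta_le_norm_riemannZeta_re (s := z + 1) (by simpa)
  refine h.trans ?_
  have hne : (((z + 1).re : ℝ) : ℂ) ≠ 1 := by
    simp only [add_re, one_re]; norm_cast; linarith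
  rw [riemannZeta_eq_inv_sub_mul hne, norm_mul, norm_inv, inv_mul_eq_div]
  have h1 := norm_riemannZeta₁_le (s := ((z + 1).re : ℝ)) (by simp; linarith)
  have e1 : ‖(((z + 1).re : ℝ) : ℂ) - 1‖ = z.re := by
    rw [← ofReal_one, ← ofReal_sub, norm_real]; simp [abs_of_pos hz]
  have e2 : ‖(((z + 1).re : ℝ) : ℂ)‖ = z.re + 1 := by
    rw [norm_real, Real.norm_of_nonneg (by simp; linarith)]; simp
  rw [e1, e2, ofReal_re] at h1
  rw [e1]
  gcongr
  refine h1.trans (le_of_eq ?_)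
  simp only [add_re, one_re]
  field_simp
  ring

/-! ### The entire function `s (s - 1) ξ(s)` and the quotient of its translates -/

/-- The entire function `s (s - 1) ξ(s)`. The definition uses `completedRiemannZeta₀`, which is `ξ`
without its polar part `-1/s - 1/(1-s)`; this gives the correct values `1` at the poles `0` and `1`
of `ξ`. -/
noncomputable def entireXi (s : ℂ) : ℂ := s * (s - 1) * completedRiemannZeta₀ s + 1

lemma differentiable_entireXi : Differentiable ℂ entireXi := by
  have := differentiable_completedZeta₀
  unfold entireXi
  fun_prop

lemma entireXi_eq {s : ℂ} (h0 : s ≠ 0) (h1 : s ≠ 1) :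
    entireXi s = s * (s - 1) * completedRiemannZeta s := by
  have h1' : 1 - s ≠ 0 := sub_ne_zero.2 h1.symm
  rw [completedRiemannZeta_eq, entireXi]
  field_simp
  ring

lemma entireXi_one_sub (s : ℂ) : entireXi (1 - s) = entireXi s := by
  rw [entireXi, entireXi, completedRiemannZeta₀_one_sub]
  ring

lemma entireXi_eq_mul_riemannZeta₁ {s : ℂ} (hs : 0 < s.re) :
    entireXi s = s * Gammaℝ s * riemannZeta₁ s := by
  rcases eq_or_ne s 1 with rfl | h1
  · simp [entireXi]
  have h0 : s ≠ 0 := by rintro rfl; simp at hs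
  have h1' : s - 1 ≠ 0 := sub_ne_zero.2 h1
  have h := riemannZeta_eq_inv_sub_mul h1
  rw [riemannZeta_def_of_ne_zero h0, inv_mul_eq_div,
    div_eq_div_iff (Gammaℝ_ne_zero_of_re_pos hs) h1'] at h
  rw [entireXi_eq h0 h1]
  linear_combination s * h

lemma riemannZeta₁_ne_zero_of_one_le_re {s : ℂ} (hs : 1 ≤ s.re) : riemannZeta₁ s ≠ 0 := by
  rcases eq_or_ne s 1 with rfl | h1
  · simp
  intro h
  apply riemannZeta_ne_zero_of_one_le_re hs
  rw [riemannZeta_eq_inv_sub_mul h1, h, mul_zero]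

lemma entireXi_ne_zero_of_one_le_re {s : ℂ} (hs : 1 ≤ s.re) : entireXi s ≠ 0 := by
  have h0 : 0 < s.re := by linarith
  rw [entireXi_eq_mul_riemannZeta₁ h0]
  refine mul_ne_zero (mul_ne_zero ?_ (Gammaℝ_ne_zero_of_re_pos h0))
    (riemannZeta₁_ne_zero_of_one_le_re hs)
  rintro rfl; simp at h0

lemma riemannZeta₁_conj (s : ℂ) : riemannZeta₁ (conj s) = conj (riemannZeta₁ s) := by
  rcases eq_or_ne s 1 with rfl | h1
  · simp
  have h1' : conj s ≠ 1 := (map_ne_one_iff _ (starRingEnd ℂ).injective).mpr h1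
  have h := riemannZeta_conj s
  rw [riemannZeta_eq_inv_sub_mul h1, riemannZeta_eq_inv_sub_mul h1', map_mul, map_inv₀, map_sub,
    map_one] at h
  exact mul_left_cancel₀ (inv_ne_zero (sub_ne_zero.2 h1')) h

lemma entireXi_conj {s : ℂ} (hs : 0 < s.re) : entireXi (conj s) = conj (entireXi s) := by
  rw [entireXi_eq_mul_riemannZeta₁ hs, entireXi_eq_mul_riemannZeta₁ (by simpa), map_mul, map_mul,
    Gammaℝ_conj, riemannZeta₁_conj]

/-- The quotient `X(z) / X(z + 1)` with `X = entireXi`. Its denominator does not vanish on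
`Re z ≥ 0`. -/
noncomputable def xiQuotient (z : ℂ) : ℂ := entireXi z / entireXi (z + 1)

lemma differentiableAt_xiQuotient {z : ℂ} (hz : 0 ≤ z.re) : DifferentiableAt ℂ xiQuotient z := by
  have h1 := differentiable_entireXi
  have h2 := entireXi_ne_zero_of_one_le_re (s := z + 1) (by simpa)
  unfold xiQuotient
  fun_prop (disch := assumption)

/-- On the imaginary axis, `X(iy) = X(1 - iy)` is the complex conjugate of `X(1 + iy)`. -/
lemma norm_xiQuotient_mul_I (y : ℝ) : ‖xiQuotient (y * I)‖ = 1 := by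
  have h : entireXi (y * I) = conj (entireXi (y * I + 1)) := by
    rw [← entireXi_conj (by simp), ← entireXi_one_sub]
    congr 1
    simp
    ring
  have h2 := entireXi_ne_zero_of_one_le_re (s := y * I + 1) (by simp)
  rw [xiQuotient, norm_div, h, norm_conj, div_self (norm_ne_zero_iff.2 h2)]

/-- The value at `1` is `3 / π`, which rules out that the quotient has constant absolute value. -/
lemma norm_xiQuotient_one_ne : ‖xiQuotient 1‖ ≠ 1 := by
  have h1 : entireXi 1 = 1 := by simp [entireXi]
  have h2 : entireXi (1 + 1) = (Real.pi / 3 : ℝ) := by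
    rw [entireXi_eq_mul_riemannZeta₁ (by simp)]
    have h := riemannZeta_eq_inv_sub_mul (s := 2) (by norm_num)
    rw [riemannZeta_two, show (2 : ℂ) - 1 = 1 by norm_num, inv_one, one_mul] at h
    rw [one_add_one_eq_two, ← h, Gammaℝ_def]
    have : (Real.pi : ℂ) ≠ 0 := by exact_mod_cast Real.pi_ne_zero
    simp [cpow_neg_one]
    field_simp
    norm_num
  rw [xiQuotient, h1, h2, norm_div, norm_one, norm_real, Real.norm_of_nonneg (by positivity)]
  have := Real.pi_gt_three
  intro h
  rw [div_eq_iff (by positivity)] at h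
  linarith

/-- Polynomial growth up to a factor `(Re z)^(-2)`, which degenerates at the imaginary axis. -/
lemma norm_xiQuotient_le {z : ℂ} (hz : 0 < z.re) :
    ‖xiQuotient z‖ ≤ 2 * (1 + 2 * ‖z‖) * (1 + 2 * z.re) / z.re ^ 2 := by
  have hz0 : z ≠ 0 := by rintro rfl; simp at hz
  have hz1 : z + 1 ≠ 0 := by
    intro h; have := congrArg re h; simp at this; linarith
  have hz1re : 0 < (z + 1).re := by simp; linarith
  have hG := Gammaℝ_ne_zero_of_re_pos hz1re
  have hne := riemannZeta_ne_zero_of_one_le_re (s := z + 1) (by simp; linarith)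
  have hzeta : riemannZeta₁ (z + 1) = z * riemannZeta (z + 1) := by
    rw [riemannZeta_eq_inv_sub_mul (by simpa), add_sub_cancel_right, mul_inv_cancel_left₀ hz0]
  have e : xiQuotient z = (z + 1)⁻¹ * (Gammaℝ z / Gammaℝ (z + 1)) * riemannZeta₁ z
      * (riemannZeta (z + 1))⁻¹ := by
    rw [xiQuotient, entireXi_eq_mul_riemannZeta₁ hz, entireXi_eq_mul_riemannZeta₁ hz1re, hzeta]
    field_simp
  have hp : 0 < ‖z‖ := norm_pos_iff.2 hz0
  have hp1 : 0 < ‖z + 1‖ := norm_pos_iff.2 hz1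
  have hsub : ‖z - 1‖ ≤ ‖z‖ + 1 := by simpa using norm_sub_le z 1
  have hre := re_le_norm z
  rw [e, norm_mul, norm_mul, norm_mul, norm_inv]
  calc _ ≤ ‖z + 1‖⁻¹ * (2 * (‖z + 1‖ / ‖z‖)) * (‖z‖ * (1 + ‖z - 1‖ / z.re))
        * ((1 + 2 * z.re) / z.re) := by
        gcongr
        · exact norm_Gammaℝ_div_Gammaℝ_add_one_le hz
        · exact norm_riemannZeta₁_le hz
        · exact norm_inv_riemannZeta_le hz
    _ = 2 * (z.re + ‖z - 1‖) * (1 + 2 * z.re) / z.re ^ 2 := by field_simp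
    _ ≤ _ := by
        have : z.re + ‖z - 1‖ ≤ 1 + 2 * ‖z‖ := by linarith
        gcongr

lemma norm_xiQuotient_le_of_one_le_re {z : ℂ} (hz : 1 ≤ z.re) :
    ‖xiQuotient z‖ ≤ 6 * (1 + 2 * ‖z‖) := by
  refine (norm_xiQuotient_le (by linarith)).trans ?_
  rw [div_le_iff₀ (by positivity)]
  have : 0 ≤ 1 + 2 * ‖z‖ := by positivity
  nlinarith [mul_nonneg this (by nlinarith : 0 ≤ 3 * z.re ^ 2 - (1 + 2 * z.re))]

/-! ### The quotient is less than one in absolute value -/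

/-- The bound on the imaginary axis removes the factor `(Re z)^(-2)` of `norm_xiQuotient_le`: on the
rectangle with vertices `i (Im z ± 1)` and `1 + i (Im z ± 1)`, apply the maximum principle to the
quotient multiplied by `(w - i (Im z + 1))² (w - i (Im z - 1))²`. On a horizontal side one of these
squares has absolute value `(Re w)²`; at `z` itself both have absolute value at least `1`. -/
lemma norm_xiQuotient_le_of_re_le_one {z : ℂ} (hz : 0 ≤ z.re) (hz1 : z.re ≤ 1) :
    ‖xiQuotient z‖ ≤ 150 * (7 + 2 * ‖z‖) := by
  set y := z.im with hy
  set C : ℝ := 150 * (7 + 2 * ‖z‖)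
  let h : ℂ → ℂ := fun w ↦ xiQuotient w * ((w - ⟨0, y + 1⟩) ^ 2 * (w - ⟨0, y - 1⟩) ^ 2)
  let R : Set ℂ := Ioo 0 1 ×ℂ Ioo (y - 1) (y + 1)
  have hyy : y - 1 ≠ y + 1 := by linarith
  have hcl : closure R = Icc 0 1 ×ℂ Icc (y - 1) (y + 1) := by
    rw [closure_reProdIm, closure_Ioo zero_ne_one, closure_Ioo hyy]
  have hR : Bornology.IsBounded R :=
    (Metric.isBounded_Ioo 0 1).reProdIm (Metric.isBounded_Ioo (y - 1) (y + 1))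
  have hnorm (w : ℂ) : ‖h w‖ = ‖xiQuotient w‖ *
      ((w.re ^ 2 + (w.im - (y + 1)) ^ 2) * (w.re ^ 2 + (w.im - (y - 1)) ^ 2)) := by
    have hsq (a b : ℂ) : ‖(a - b) ^ 2‖ = (a.re - b.re) ^ 2 + (a.im - b.im) ^ 2 := by
      rw [norm_pow, ← normSq_eq_norm_sq, normSq_apply]
      simp only [sub_re, sub_im]
      ring
    simp [h, hsq]
  have hd : DiffContOnCl ℂ h R := by
    refine DifferentiableOn.diffContOnCl fun w hw ↦ ?_
    rw [hcl] at hw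
    have := differentiableAt_xiQuotient hw.1.1
    exact DifferentiableAt.differentiableWithinAt (by fun_prop)
  have hfr : ∀ w ∈ frontier R, ‖h w‖ ≤ C := by
    intro w hw
    have hwcl : w ∈ closure R := frontier_subset_closure hw
    rw [hcl] at hwcl
    obtain ⟨⟨hr0, hr1⟩, hi0, hi1⟩ := hwcl
    have hwz : ‖w‖ ≤ ‖z‖ + 3 := by
      have h1 : ‖w - z‖ ≤ |w.re - z.re| + |w.im - z.im| := by
        simpa using norm_le_abs_re_add_abs_im (w - z)
      have h2 : |w.re - z.re| ≤ 1 := abs_le.2 ⟨by linarith, by linarith⟩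
      have h3 : |w.im - z.im| ≤ 1 := abs_le.2 ⟨by linarith, by linarith⟩
      have := norm_le_norm_add_norm_sub' w z
      linarith
    have hA : w.re ^ 2 + (w.im - (y + 1)) ^ 2 ≤ 5 := by nlinarith
    have hB : w.re ^ 2 + (w.im - (y - 1)) ^ 2 ≤ 5 := by nlinarith
    have hA0 : 0 ≤ w.re ^ 2 + (w.im - (y + 1)) ^ 2 := by positivity
    have hB0 : 0 ≤ w.re ^ 2 + (w.im - (y - 1)) ^ 2 := by positivity
    have hvert (K : ℝ) (hK : ‖xiQuotient w‖ ≤ K) (hKC : 25 * K ≤ C) : ‖h w‖ ≤ C := by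
      have hK0 : 0 ≤ K := (norm_nonneg _).trans hK
      rw [hnorm]
      calc _ ≤ K * (5 * 5) := by gcongr
        _ ≤ C := by linarith
    have hz0 := norm_nonneg z
    rcases hr0.eq_or_lt with h0 | h0
    · refine hvert 1 ?_ (by simp only [C]; linarith)
      have : w = w.im * I := by apply Complex.ext <;> simp [← h0]
      rw [this, norm_xiQuotient_mul_I]
    rcases hr1.eq_or_lt with h1 | h1
    · refine hvert _ (norm_xiQuotient_le_of_one_le_re h1.ge) ?_
      simp only [C]; linarith
    -- On a horizontal side, `w.re ^ 2` cancels the denominator in `norm_xiQuotient_le`.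
    have hhor (P : ℝ) (hP : 0 ≤ P) (hP5 : P ≤ 5) (hw : ‖h w‖ = ‖xiQuotient w‖ * (w.re ^ 2 * P)) :
        ‖h w‖ ≤ C := by
      rw [hw]
      calc _ ≤ 2 * (1 + 2 * ‖w‖) * (1 + 2 * w.re) / w.re ^ 2 * (w.re ^ 2 * P) := by
            gcongr
            exact norm_xiQuotient_le h0
        _ = 2 * (1 + 2 * ‖w‖) * (1 + 2 * w.re) * P := by field_simp
        _ ≤ 2 * (1 + 2 * (‖z‖ + 3)) * (1 + 2 * 1) * 5 := by gcongr
        _ ≤ C := by simp only [C]; linarith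
    rw [frontier_reProdIm, frontier_Ioo (by linarith : y - 1 < y + 1), frontier_Ioo one_pos] at hw
    rcases hw with hw | hw
    · rcases hw.2 with hi | hi
      · refine hhor _ hA0 hA ?_
        rw [hnorm, hi]; ring
      · refine hhor _ hB0 hB ?_
        rw [hnorm, show w.im = y + 1 from hi]; ring
    · rcases hw.1 with hi | hi
      · exact absurd hi h0.ne'
      · exact absurd hi h1.ne
  have hzR : z ∈ closure R := by
    rw [hcl]
    exact ⟨⟨hz, hz1⟩, by simp [← hy], by simp [← hy]⟩
  have := norm_le_of_forall_mem_frontier_norm_le hR hd hfr hzR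
  refine le_trans ?_ this
  rw [hnorm]
  refine le_mul_of_one_le_right (norm_nonneg _) ?_
  refine one_le_mul_of_one_le_of_one_le ?_ ?_ <;> nlinarith [sq_nonneg z.re]

lemma norm_xiQuotient_le_const_mul {z : ℂ} (hz : 0 ≤ z.re) :
    ‖xiQuotient z‖ ≤ 150 * (7 + 2 * ‖z‖) := by
  rcases le_total z.re 1 with h | h
  · exact norm_xiQuotient_le_of_re_le_one hz h
  · refine (norm_xiQuotient_le_of_one_le_re h).trans ?_
    linarith [norm_nonneg z]

/-- Phragmén–Lindelöf in the right half-plane: the quotient grows polynomially, is bounded on the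
positive real axis, and has absolute value `1` on the imaginary axis. -/
lemma norm_xiQuotient_le_one {z : ℂ} (hz : 0 ≤ z.re) : ‖xiQuotient z‖ ≤ 1 := by
  refine PhragmenLindelof.right_half_plane_of_bounded_on_real (f := xiQuotient) ?_
    ⟨1, by norm_num, 1, ?_⟩ ?_ (fun x ↦ (norm_xiQuotient_mul_I x).le) hz
  · refine DifferentiableOn.diffContOnCl fun w hw ↦ ?_
    rw [closure_setOfPred_lt_re] at hw
    exact (differentiableAt_xiQuotient hw).differentiableWithinAt
  · refine IsBigO.of_bound 1050 (eventually_inf_principal.2 (Eventually.of_forall fun w hw ↦ ?_))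
    refine (norm_xiQuotient_le_const_mul (le_of_lt hw)).trans ?_
    rw [Real.rpow_one, one_mul, Real.norm_of_nonneg (Real.exp_pos _).le]
    linarith [Real.add_one_le_exp ‖w‖, norm_nonneg w]
  · refine isBoundedUnder_of_eventually_le (a := 18) ?_
    filter_upwards [eventually_ge_atTop 1] with x hx
    have hx0 : 0 < x := by linarith
    refine (norm_xiQuotient_le (by simpa)).trans ?_
    rw [norm_real, Real.norm_of_nonneg hx0.le, ofReal_re, div_le_iff₀ (by positivity)]
    nlinarith

lemma norm_xiQuotient_lt_one {z : ℂ} (hz : 0 < z.re) : ‖xiQuotient z‖ < 1 := by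
  refine (norm_xiQuotient_le_one hz.le).lt_of_ne fun h ↦ norm_xiQuotient_one_ne ?_
  have := norm_eqOn_of_isPreconnected_of_isMaxOn (f := xiQuotient) (U := {z : ℂ | 0 < z.re})
    (c := z) (convex_halfSpace_re_gt 0).isPreconnected (isOpen_lt continuous_const continuous_re)
    (fun w hw ↦ (differentiableAt_xiQuotient (le_of_lt hw)).differentiableWithinAt) hz
    (fun w hw ↦ by simpa [h] using norm_xiQuotient_le_one (le_of_lt hw))
  simpa [h] using this (show (1 : ℂ) ∈ {z : ℂ | 0 < z.re} by simp)

lemma norm_entireXi_lt_norm_entireXi_add_one {z : ℂ} (hz : 0 < z.re) :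
    ‖entireXi z‖ < ‖entireXi (z + 1)‖ := by
  have h := norm_xiQuotient_lt_one hz
  have h2 := norm_pos_iff.2 (entireXi_ne_zero_of_one_le_re (s := z + 1) (by simpa using hz.le))
  rwa [xiQuotient, norm_div, div_lt_one h2] at h

/-! ### Zeros of the rank two zeta function -/

/-- The entire function `2 s (s - 1) (2 s - 1) ξ^T_{ℚ,2}(s)`, written through `entireXi`. -/
noncomputable def rankTwoNumerator (T : ℝ) (s : ℂ) : ℂ :=
  entireXi (2 * s) * (T : ℂ) ^ (s - 1) - entireXi (2 * s - 1) * (T : ℂ) ^ (-s)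

lemma differentiable_rankTwoNumerator {T : ℝ} (hT : 0 < T) :
    Differentiable ℂ (rankTwoNumerator T) := by
  have h1 := differentiable_entireXi
  have hT0 : (T : ℂ) ≠ 0 := by exact_mod_cast hT.ne'
  unfold rankTwoNumerator
  fun_prop (disch := simp [hT0])

lemma rankTwoNumerator_one_sub (T : ℝ) (s : ℂ) :
    rankTwoNumerator T (1 - s) = -rankTwoNumerator T s := by
  rw [rankTwoNumerator, rankTwoNumerator, ← entireXi_one_sub (2 * (1 - s)),
    ← entireXi_one_sub (2 * (1 - s) - 1)]
  ring_nf

/-- To the right of the critical line, the first term of the numerator dominates the second one. -/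
lemma rankTwoNumerator_ne_zero_of_half_lt_re {T : ℝ} (hT : 1 ≤ T) {s : ℂ} (hs : 1 / 2 < s.re) :
    rankTwoNumerator T s ≠ 0 := by
  have hT0 : 0 < T := by linarith
  have hX := norm_entireXi_lt_norm_entireXi_add_one (z := 2 * s - 1) (by simp; linarith)
  rw [sub_add_cancel] at hX
  intro h
  rw [rankTwoNumerator, sub_eq_zero] at h
  have h' := congrArg norm h
  rw [norm_mul, norm_mul, norm_cpow_eq_rpow_re_of_pos hT0, norm_cpow_eq_rpow_re_of_pos hT0] at h'
  have hpow : T ^ (-s).re ≤ T ^ (s - 1).re :=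
    Real.rpow_le_rpow_of_exponent_le hT (by simp; linarith)
  have hpos : 0 < T ^ (s - 1).re := Real.rpow_pos_of_pos hT0 _
  refine absurd h' (ne_of_gt ?_)
  calc _ ≤ ‖entireXi (2 * s - 1)‖ * T ^ (s - 1).re := by gcongr
    _ < _ := by gcongr

lemma rankTwoNumerator_ne_zero {T : ℝ} (hT : 1 ≤ T) {s : ℂ} (hs : s.re ≠ 1 / 2) :
    rankTwoNumerator T s ≠ 0 := by
  rcases hs.lt_or_gt with h | h
  · have := rankTwoNumerator_ne_zero_of_half_lt_re hT (s := 1 - s) (by simp; linarith)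
    rwa [rankTwoNumerator_one_sub, neg_ne_zero] at this
  · exact rankTwoNumerator_ne_zero_of_half_lt_re hT h

lemma rankTwoXi_eq_div (T : ℝ) {s : ℂ} (h0 : s ≠ 0) (h1 : s ≠ 1) (h2 : 2 * s - 1 ≠ 0) :
    rankTwoXi T s = rankTwoNumerator T s / (2 * s * (s - 1) * (2 * s - 1)) := by
  have h1' : s - 1 ≠ 0 := sub_ne_zero.2 h1
  have h3 : 2 * s - 1 ≠ 1 := fun h ↦ h1 (by linear_combination h / 2)
  rw [rankTwoXi, rankTwoNumerator, entireXi_eq (by simpa) (sub_ne_zero.1 h2), entireXi_eq h2 h3]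
  field_simp
  ring

lemma eventually_rankTwoXi_eq_div (T : ℝ) (s : ℂ) : ∀ᶠ w in 𝓝[≠] s,
    2 * w * (w - 1) * (2 * w - 1) ≠ 0 ∧
      rankTwoXi T w = rankTwoNumerator T w / (2 * w * (w - 1) * (2 * w - 1)) := by
  have hfin : (({0, 1, 1 / 2} : Set ℂ) \ {s}).Finite := (by simp : Set.Finite _).sdiff
  filter_upwards [mem_nhdsWithin_of_mem_nhds (hfin.isClosed.isOpen_compl.mem_nhds (by simp)),
    self_mem_nhdsWithin] with w hw hws
  have hw' : w ∉ ({0, 1, 1 / 2} : Set ℂ) := fun h ↦ hw ⟨h, hws⟩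
  simp only [mem_insert_iff, mem_singleton_iff, not_or] at hw'
  obtain ⟨h0, h1, h2⟩ := hw'
  have h2' : 2 * w - 1 ≠ 0 := fun h ↦ h2 (by linear_combination h / 2)
  exact ⟨by simp [h0, h2', sub_ne_zero.2 h1], rankTwoXi_eq_div T h0 h1 h2'⟩

/-- For `T ≥ 1` the function `ξ^T_{ℚ,2}` is meromorphic on `ℂ`, and each of its zeros (points of
positive order) lies on the line `Re s = 1/2`. -/
theorem mainTheorem6 (T : ℝ) (hT : 1 ≤ T) :
    Meromorphic (rankTwoXi T) ∧
      ∀ s : ℂ, 0 < meromorphicOrderAt (rankTwoXi T) s → s.re = 1 / 2 := by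
  have hN (s : ℂ) : AnalyticAt ℂ (rankTwoNumerator T) s :=
    (differentiable_rankTwoNumerator (by linarith)).analyticAt s
  have hD (s : ℂ) : AnalyticAt ℂ (fun w : ℂ ↦ 2 * w * (w - 1) * (2 * w - 1)) s := by fun_prop
  refine ⟨fun s ↦ ((hN s).meromorphicAt.div (hD s).meromorphicAt).congr ?_, fun s hs ↦ ?_⟩
  · filter_upwards [eventually_rankTwoXi_eq_div T s] with w hw using hw.2.symm
  by_contra hre
  -- At a zero, `rankTwoXi T` tends to `0`, hence so does its product with the polynomial; a zero at
  -- `0` or `1`, where the polynomial vanishes, needs no separate treatment.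
  have h0 : Tendsto (rankTwoNumerator T) (𝓝[≠] s) (𝓝 0) := by
    have h := (tendsto_zero_of_meromorphicOrderAt_pos hs).mul
      ((hD s).continuousAt.tendsto.mono_left nhdsWithin_le_nhds)
    rw [zero_mul] at h
    refine h.congr' ?_
    filter_upwards [eventually_rankTwoXi_eq_div T s] with w hw
    rw [hw.2, div_mul_cancel₀ _ hw.1]
  exact rankTwoNumerator_ne_zero hT hre (tendsto_nhds_unique
    ((hN s).continuousAt.tendsto.mono_left nhdsWithin_le_nhds) h0)
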